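/- Let $\mathcal H$ be a finite-dimensional complex Hilbert space, let $\rho$ be a density operator on $\mathcal H$ (positive semidefinite, $\operatorname{tr}\rho=1$), let $\sigma$ be a positive semidefinite operator on $\mathcal H$ and let $r\in\mathbb R$. Suppose that $\rho$ and $\sigma$ commute. Then, in $[-\infty,+\infty]$, $$\lim_{n\to\infty}\frac{-1}{n}\log\bigl(1-\epsilon(\rho^{\otimes n}\|\sigma^{\otimes n},nr)\bigr)=\sup_{\frac12\le\alpha<1}\frac{1-\alpha}{\alpha}\bigl\{D^*_\alpha(\rho\|\sigma)-r\bigr\}.$$ Here all logarithms are to base $2$, $\log 0=-\infty$, and: - for a state $\rho$, a positive semidefinite $\sigma$ and $\lambda\in\mathbb R$, the smoothing quantity of the max-relative entropy is $$\epsilon(\rho\|\sigma,\lambda)=\min\bigl\{P(\rho,\tilde\rho)\;:\;\tilde\rho\ge 0,\ \operatorname{tr}\tilde\rho\le 1,\ \tilde\rho\le 2^{\lambda}\sigma\bigr\},$$ where $P(\rho,\tilde\rho)=\sqrt{1-F(\rho,\tilde\rho)^2}$ is the purified distance and $F(\rho,\tilde\rho)=\|\sqrt{\rho}\sqrt{\tilde\rho}\|_1+\sqrt{(1-\operatorname{tr}\rho)(1-\operatorname{tr}\tilde\rho)}$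 is the fidelity, with $\|A\|_1=\operatorname{tr}\sqrt{A^\dagger A}$; - for $\alpha\in(0,1)$, the sandwiched Rényi divergence is $$D^*_\alpha(\rho\|\sigma)=\frac{1}{\alpha-1}\log\operatorname{tr}\Bigl(\sigma^{\frac{1-\alpha}{2\alpha}}\rho\,\sigma^{\frac{1-\alpha}{2\alpha}}\Bigr)^{\alpha}$$ if the supports of $\rho$ and $\sigma$ are not orthogonal, and $D^*_\alpha(\rho\|\sigma)=+\infty$ otherwise. -/

import Mathlib

open scoped ComplexOrder

noncomputable section

namespace StrongConverse

/-- Density matrices on `ℂ^d`: positive semidefinite with trace one. -/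
def IsState {d : Type*} [Fintype d] (ρ : Matrix d d ℂ) : Prop :=
  ρ.PosSemidef ∧ ρ.trace = 1

/-- Subnormalized states on `ℂ^d`: positive semidefinite with trace at most one. -/
def IsSubState {d : Type*} [Fintype d] (ρ : Matrix d d ℂ) : Prop :=
  ρ.PosSemidef ∧ ρ.trace.re ≤ 1

/-- The `n`-fold tensor power `ρ^{⊗ n}`, acting on `(ℂ^d)^{⊗ n} = ℂ^(Fin n → d)`. -/
def tensorPower {d : Type*} (ρ : Matrix d d ℂ) (n : ℕ) :
    Matrix (Fin n → d) (Fin n → d) ℂ :=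
  Matrix.of fun i j => ∏ k, ρ (i k) (j k)

/-- The real power `A^s` of a positive semidefinite matrix, by functional calculus on the
eigenvalues (with `0^s = 0` for `s ≠ 0`). -/
def mpow {d : Type*} [Fintype d] [DecidableEq d] (A : Matrix d d ℂ) (s : ℝ) : Matrix d d ℂ :=
  cfc (fun x : ℝ => x ^ s) A

/-- The square root of a positive semidefinite matrix. -/
def msqrt {d : Type*} [Fintype d] [DecidableEq d] (A : Matrix d d ℂ) : Matrix d d ℂ :=
  cfc Real.sqrt A

/-- The trace norm `‖A‖₁ = tr √(A† A)`. -/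
def traceNorm {d : Type*} [Fintype d] [DecidableEq d] (A : Matrix d d ℂ) : ℝ :=
  (msqrt (A.conjTranspose * A)).trace.re

/-- The (generalized) fidelity of subnormalized states,
`F(ρ, σ) = ‖√ρ √σ‖₁ + √((1 - tr ρ) (1 - tr σ))`. -/
def fidelity {d : Type*} [Fintype d] [DecidableEq d] (ρ σ : Matrix d d ℂ) : ℝ :=
  traceNorm (msqrt ρ * msqrt σ) + Real.sqrt ((1 - ρ.trace.re) * (1 - σ.trace.re))

/-- The purified distance `P(ρ, σ) = √(1 - F(ρ, σ)²)`. -/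
def purifiedDistance {d : Type*} [Fintype d] [DecidableEq d] (ρ σ : Matrix d d ℂ) : ℝ :=
  Real.sqrt (1 - fidelity ρ σ ^ 2)

/-- The smoothing quantity of the max-relative entropy,
`ε(ρ ‖ σ, lam) = min {P(ρ, τ) | τ a subnormalized state with τ ≤ 2^lam σ}`,
where `≤` is the Loewner order. The set is nonempty (it contains `P(ρ, 0)`) and bounded below
by zero. -/
def smoothingQuantity {d : Type*} [Fintype d] [DecidableEq d]
    (ρ σ : Matrix d d ℂ) (lam : ℝ) : ℝ :=
  sInf {e : ℝ | ∃ τ : Matrix d d ℂ,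
    IsSubState τ ∧ (((2 : ℝ) ^ lam) • σ - τ).PosSemidef ∧ e = purifiedDistance ρ τ}

/-- The support of a Hermitian matrix, i.e. its range. -/
def supp {d : Type*} [Fintype d] [DecidableEq d] (A : Matrix d d ℂ) :
    Submodule ℂ (EuclideanSpace ℂ d) :=
  LinearMap.range (Matrix.toEuclideanLin A)

/-- `Q*_α(ρ ‖ σ) = tr (σ^{(1-α)/(2α)} ρ σ^{(1-α)/(2α)})^α`. -/
def sandwichedQ {d : Type*} [Fintype d] [DecidableEq d] (α : ℝ) (ρ σ : Matrix d d ℂ) : ℝ :=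
  (mpow (mpow σ ((1 - α) / (2 * α)) * ρ * mpow σ ((1 - α) / (2 * α))) α).trace.re

open scoped Classical in
/-- The sandwiched Rényi divergence of order `α ∈ (0, 1) ∪ (1, ∞)`, with logarithm to base 2. -/
def sandwichedRenyi {d : Type*} [Fintype d] [DecidableEq d] (α : ℝ) (ρ σ : Matrix d d ℂ) :
    EReal :=
  if (1 < α ∧ supp ρ ≤ supp σ) ∨ (0 < α ∧ α < 1 ∧ ¬ (supp ρ ⟂ supp σ)) then
    ((1 / (α - 1) * Real.logb 2 (sandwichedQ α ρ σ) : ℝ) : EReal)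
  else ⊤

/-- The base-2 logarithm of a nonnegative real as an extended real, with `log 0 = -∞`. -/
def elog2 (x : ℝ) : EReal :=
  if x ≤ 0 then ⊥ else ((Real.logb 2 x : ℝ) : EReal)

end StrongConverse

end

/-! ### Simultaneous diagonalization and functional calculus in a fixed eigenbasis. -/

namespace StrongConverse

open Matrix

variable {d : Type*} [Fintype d] [DecidableEq d]

/-! Commuting `ρ` and `σ` share an eigenbasis; let `p`, `q` be their eigenvalues. Replacing a
candidate `τ` by its diagonal in that basis keeps it feasible and cannot lower its fidelity with `ρ`
(`traceNorm_msqrt_diagConj_mul_le`). So the problem is classical: maximize `F = ∑ √p √t` over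
subdistributions `t ≤ 2^λ q`. Since `F²/2 ≤ 1 - √(1 - F²) ≤ F²`, only the exponent of `F²` matters.

The exponent is bounded below by Hölder: `F² ≤ (∑ p^α (2^λ q)^(1-α))^(1/α)` for `1/2 ≤ α < 1`
(`sq_sum_sqrt_mul_sqrt_le`), and the sum factorizes over tensor powers.

It is bounded above by a change of measure: for a distribution `w` on the joint support, `t =
min(w^n, 2^(nr) q^n)` is feasible, and Jensen with a variance estimate gives exponent at most
`D(w‖p) + (D(w‖q) - r)⁺ + O(n^(-1/2))` (`exists_exp_le_sq_sum_sqrt`).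

The bounds meet by a saddle-point argument. Write `x⁺ = max_{0≤s≤1} s x`. For fixed `s = (1-α)/α`,
the functional `D(w‖p) + s (D(w‖q) - r)` is minimized by `w ∝ (p q^s)^(1/(1+s))`, with value
`expRate`, the Hölder exponent at `α`. At a maximizer `s`, the first-order conditions replace `s x`
by `x⁺` (`exists_isMaxOn_expRate`). With orthogonal supports both sides are `+∞`. -/

/-- The matrix `U diag(x) U†` for a unitary `U`, as an algebra homomorphism in `x`. -/
noncomputable def diagConj (U : Matrix.unitaryGroup d ℂ) : (d → ℝ) →ₐ[ℝ] Matrix d d ℂ :=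
  ((Unitary.conjStarAlgAut ℝ (Matrix d d ℂ) U : Matrix d d ℂ ≃⋆ₐ[ℝ] Matrix d d ℂ).toAlgEquiv :
      Matrix d d ℂ →ₐ[ℝ] Matrix d d ℂ).comp
    ((Matrix.diagonalAlgHom ℝ).comp (Complex.ofRealAm.compLeft d))

theorem diagConj_apply (U : Matrix.unitaryGroup d ℂ) (x : d → ℝ) :
    diagConj U x = (U : Matrix d d ℂ) * Matrix.diagonal (fun i => (x i : ℂ)) * star (U : Matrix d d ℂ) :=
  rfl

theorem isHermitian_diagConj (U : Matrix.unitaryGroup d ℂ) (x : d → ℝ) :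
    (diagConj U x).IsHermitian := by
  rw [diagConj_apply, Matrix.IsHermitian, ← star_eq_conjTranspose]
  simp [mul_assoc, star_eq_conjTranspose, diagonal_conjTranspose, Pi.star_def]

theorem star_mul_diagConj_mul (U : Matrix.unitaryGroup d ℂ) (x : d → ℝ) :
    star (U : Matrix d d ℂ) * diagConj U x * (U : Matrix d d ℂ) =
      Matrix.diagonal (fun i => (x i : ℂ)) := by
  have h := Unitary.coe_star_mul_self U
  rw [diagConj_apply]
  calc _ = (star (U : Matrix d d ℂ) * U) * Matrix.diagonal (fun i => (x i : ℂ)) *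
        (star (U : Matrix d d ℂ) * U) := by simp only [mul_assoc]
    _ = _ := by rw [h]; simp

theorem trace_star_mul_mul (U : Matrix.unitaryGroup d ℂ) (A : Matrix d d ℂ) :
    (star (U : Matrix d d ℂ) * A * (U : Matrix d d ℂ)).trace = A.trace := by
  rw [Matrix.trace_mul_comm, ← mul_assoc, Unitary.mul_star_self_of_mem U.2, one_mul]

theorem trace_diagConj (U : Matrix.unitaryGroup d ℂ) (x : d → ℝ) :
    (diagConj U x).trace = ((∑ i, x i : ℝ) : ℂ) := by
  rw [← trace_star_mul_mul U, star_mul_diagConj_mul, Matrix.trace_diagonal]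
  simp

theorem diagConj_injective (U : Matrix.unitaryGroup d ℂ) : Function.Injective (diagConj U) := by
  intro x y h
  have := star_mul_diagConj_mul U x
  rw [h, star_mul_diagConj_mul, Matrix.diagonal_eq_diagonal_iff] at this
  ext i
  exact_mod_cast (this i).symm

theorem posSemidef_diagConj_iff (U : Matrix.unitaryGroup d ℂ) (x : d → ℝ) :
    (diagConj U x).PosSemidef ↔ ∀ i, 0 ≤ x i := by
  constructor
  · intro h i
    have := h.conjTranspose_mul_mul_same (U : Matrix d d ℂ)
    rw [← star_eq_conjTranspose, star_mul_diagConj_mul, Matrix.posSemidef_diagonal_iff] at this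
    exact_mod_cast this i
  · intro h
    rw [diagConj_apply, star_eq_conjTranspose]
    refine Matrix.PosSemidef.mul_mul_conjTranspose_same ?_ _
    rw [Matrix.posSemidef_diagonal_iff]
    exact fun i => by exact_mod_cast h i

/-- On a finite set every function is a polynomial, and polynomials commute with the algebra
homomorphism `diagConj U`. Interpolating at the spectrum together with the values of `x` avoids
having to identify the two sets. -/
theorem cfc_diagConj (U : Matrix.unitaryGroup d ℂ) (x : d → ℝ) (f : ℝ → ℝ) :
    cfc f (diagConj U x) = diagConj U (fun i => f (x i)) := by
  classical
  have hfin : (spectrum ℝ (diagConj U x)).Finite := Matrix.finite_real_spectrum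
  set S : Finset ℝ := hfin.toFinset ∪ Finset.univ.image x
  set P : Polynomial ℝ := Lagrange.interpolate S id f
  have hP : ∀ y ∈ S, P.eval y = f y := fun y hy =>
    Lagrange.eval_interpolate_at_node f (Function.injective_id.injOn) hy
  have hself : IsSelfAdjoint (diagConj U x) := isHermitian_diagConj U x
  rw [cfc_congr (g := P.eval), cfc_polynomial P (diagConj U x) hself, Polynomial.aeval_algHom_apply]
  · congr 1
    ext i
    rw [← hP (x i) (by simp [S])]
    have := Polynomial.aeval_algHom_apply (Pi.evalAlgHom ℝ (fun _ : d => ℝ) i) x P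
    simp
  · intro y hy
    exact (hP y (by simp [S, hy])).symm

/-- Commuting Hermitian matrices are simultaneously unitarily diagonalizable. -/
theorem exists_diagConj_of_commute {A B : Matrix d d ℂ} (hA : A.IsHermitian) (hB : B.IsHermitian)
    (h : Commute A B) : ∃ (U : Matrix.unitaryGroup d ℂ) (x y : d → ℝ),
      A = diagConj U x ∧ B = diagConj U y := by
  classical
  have hA' := Matrix.isSymmetric_toEuclideanLin_iff.mpr hA
  have hB' := Matrix.isSymmetric_toEuclideanLin_iff.mpr hB
  have hC : Commute (Matrix.toEuclideanLin A) (Matrix.toEuclideanLin B) := by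
    ext v : 1
    have := congrArg (fun M => WithLp.toLp 2 (M *ᵥ v.ofLp)) h.eq
    simpa [Matrix.toLpLin_apply, Matrix.mulVec_mulVec] using this
  have hint := LinearMap.IsSymmetric.directSum_isInternal_of_commute hA' hB' hC
  have hfam := LinearMap.IsSymmetric.orthogonalFamily_eigenspace_inf_eigenspace hA' hB'
  let v := fun i : ℂ × ℂ => stdOrthonormalBasis ℂ
    ↥(Module.End.eigenspace (Matrix.toEuclideanLin A) i.2 ⊓
      Module.End.eigenspace (Matrix.toEuclideanLin B) i.1)
  let b := hint.collectedBasis fun i => (v i).toBasis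
  have hb : Orthonormal ℂ b := hint.collectedBasis_orthonormal hfam
    (fun i => by simp)
  let : Fintype _ := FiniteDimensional.fintypeBasisIndex b
  have hcard : Fintype.card _ = Fintype.card d :=
    (Module.finrank_eq_card_basis b).symm.trans finrank_euclideanSpace
  let e := Fintype.equivOfCardEq hcard
  let c : OrthonormalBasis d ℂ (EuclideanSpace ℂ d) :=
    (b.reindex e).toOrthonormalBasis (by
      rw [Module.Basis.coe_reindex]; exact hb.comp _ e.symm.injective)
  have hc : ∀ j, c j = b (e.symm j) := fun j => by simp [c]
  have hmem : ∀ j, c j ∈ Module.End.eigenspace (Matrix.toEuclideanLin A) (e.symm j).1.2 ⊓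
      Module.End.eigenspace (Matrix.toEuclideanLin B) (e.symm j).1.1 := fun j => by
    rw [hc]
    exact hint.collectedBasis_mem (fun i => (v i).toBasis) (e.symm j)
  let U : Matrix.unitaryGroup d ℂ := ⟨(EuclideanSpace.basisFun d ℂ).toBasis.toMatrix c.toBasis,
    by simpa using (EuclideanSpace.basisFun d ℂ).toMatrix_orthonormalBasis_mem_unitary c⟩
  have hU : ∀ i j, (U : Matrix d d ℂ) i j = c j i := fun i j => by
    simp [U, Module.Basis.toMatrix_apply]
  have key : ∀ (M : Matrix d d ℂ) (α : d → ℂ), M.IsHermitian →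
      (∀ j, c j ∈ Module.End.eigenspace (Matrix.toEuclideanLin M) (α j)) →
      M = diagConj U fun j => (α j).re := by
    intro M α hM hα
    have h1 : M * (U : Matrix d d ℂ) = U * Matrix.diagonal α := by
      ext i j
      have := Module.End.mem_eigenspace_iff.mp (hα j)
      have := congrArg (fun w : EuclideanSpace ℂ d => w i) this
      simp only [Matrix.toLpLin_apply] at this
      rw [Matrix.mul_diagonal, hU, mul_comm, Matrix.mul_apply]
      simpa [hU, Matrix.mulVec, dotProduct] using this
    have h2 : M = U * Matrix.diagonal α * star (U : Matrix d d ℂ) := by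
      rw [← h1, mul_assoc, Unitary.mul_star_self_of_mem U.2, mul_one]
    -- The eigenvalues come from complex eigenspaces; hermiticity of `U† M U` shows that they are
    -- real.
    have h3 : (Matrix.diagonal α).IsHermitian := by
      have : Matrix.diagonal α = star (U : Matrix d d ℂ) * M * (U : Matrix d d ℂ) := by
        rw [mul_assoc, h1, ← mul_assoc, Unitary.coe_star_mul_self, one_mul]
      rw [this, star_eq_conjTranspose]
      exact Matrix.isHermitian_conjTranspose_mul_mul _ hM
    have h4 : (fun j => (((α j).re : ℝ) : ℂ)) = α := by
      ext j
      have := h3.apply j j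
      simp only [Matrix.diagonal_apply_eq] at this
      exact Complex.conj_eq_iff_re.mp this
    rw [diagConj_apply, h4]
    exact h2
  exact ⟨U, _, _, key A _ hA fun j => (hmem j).1, key B _ hB fun j => (hmem j).2⟩

end StrongConverse

/-! ### Tensor powers, fidelity, and reduction of smoothing to classical weights. -/

namespace StrongConverse

open Matrix

section

variable {d : Type*}

theorem tensorPower_mul [Fintype d] (A B : Matrix d d ℂ) (n : ℕ) :
    tensorPower (A * B) n = tensorPower A n * tensorPower B n := by
  classical
  ext i j
  simp only [tensorPower, Matrix.of_apply, Matrix.mul_apply, Finset.prod_univ_sum,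
    Fintype.piFinset_univ, Finset.prod_mul_distrib]

theorem tensorPower_star (A : Matrix d d ℂ) (n : ℕ) :
    tensorPower (star A) n = star (tensorPower A n) := by
  ext i j
  simp [tensorPower, Matrix.star_apply]

theorem tensorPower_diagonal [DecidableEq d] (x : d → ℂ) (n : ℕ) :
    tensorPower (Matrix.diagonal x) n = Matrix.diagonal fun i : Fin n → d => ∏ k, x (i k) := by
  ext i j
  by_cases h : i = j
  · subst h
    simp [tensorPower]
  · obtain ⟨k, hk⟩ := Function.ne_iff.mp h
    rw [Matrix.diagonal_apply_ne _ h]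
    simp only [tensorPower, Matrix.of_apply]
    exact Finset.prod_eq_zero (Finset.mem_univ k) (Matrix.diagonal_apply_ne _ hk)

theorem tensorPower_one [DecidableEq d] (n : ℕ) :
    tensorPower (1 : Matrix d d ℂ) n = 1 := by
  rw [← Matrix.diagonal_one, tensorPower_diagonal]
  simp

/-- The tensor power of a unitary matrix. -/
def unitaryTensorPower [Fintype d] [DecidableEq d] (U : Matrix.unitaryGroup d ℂ) (n : ℕ) :
    Matrix.unitaryGroup (Fin n → d) ℂ :=
  ⟨tensorPower (U : Matrix d d ℂ) n, by
    rw [Matrix.mem_unitaryGroup_iff, ← tensorPower_star, ← tensorPower_mul,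
      Unitary.mul_star_self_of_mem U.2, tensorPower_one]⟩

theorem tensorPower_diagConj [Fintype d] [DecidableEq d] (U : Matrix.unitaryGroup d ℂ)
    (x : d → ℝ) (n : ℕ) :
    tensorPower (diagConj U x) n =
      diagConj (unitaryTensorPower U n) fun i => ∏ k, x (i k) := by
  rw [diagConj_apply, diagConj_apply, tensorPower_mul, tensorPower_mul, tensorPower_star,
    tensorPower_diagonal]
  simp [unitaryTensorPower]

end

variable {d : Type*} [Fintype d] [DecidableEq d]

theorem continuousOn_spectrum (f : ℝ → ℝ) (A : Matrix d d ℂ) : ContinuousOn f (spectrum ℝ A) :=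
  (Matrix.finite_real_spectrum (A := A)).continuousOn f

theorem msqrt_mul_self {A : Matrix d d ℂ} (hA : A.PosSemidef) : msqrt A * msqrt A = A := by
  have hs : IsSelfAdjoint A := hA.isHermitian
  rw [msqrt, ← cfc_mul _ _ _ (continuousOn_spectrum _ _) (continuousOn_spectrum _ _)]
  conv_rhs => rw [← cfc_id ℝ A]
  refine cfc_congr fun x hx => ?_
  have : 0 ≤ x := by
    rw [hA.isHermitian.spectrum_real_eq_range_eigenvalues] at hx
    obtain ⟨i, rfl⟩ := hx
    exact hA.eigenvalues_nonneg i
  exact Real.mul_self_sqrt this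

theorem isHermitian_cfc (f : ℝ → ℝ) (A : Matrix d d ℂ) : (cfc f A).IsHermitian :=
  cfc_predicate f A

/-- The polar decomposition, in the form of a partial isometry that recovers the modulus. -/
theorem exists_mul_eq_msqrt (A : Matrix d d ℂ) : ∃ W : Matrix d d ℂ,
    W * A = msqrt (Aᴴ * A) ∧ (Wᴴ * W) * (Wᴴ * W) = Wᴴ * W := by
  set H := Aᴴ * A with hH
  have hs : IsSelfAdjoint H := Matrix.isHermitian_conjTranspose_mul_self A
  -- Since `0⁻¹ = 0`, `g(H)` is the pseudo-inverse of `√H`, so no invertibility of `A` is needed.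
  let g : ℝ → ℝ := fun x => (√x)⁻¹
  have hg : (cfc g H)ᴴ = cfc g H := isHermitian_cfc g H
  have hid : cfc (fun x : ℝ => x) H = H := cfc_id' ℝ H
  have hmul : ∀ u v : ℝ → ℝ, cfc u H * cfc v H = cfc (fun x => u x * v x) H := fun u v =>
    (cfc_mul _ _ _ (continuousOn_spectrum _ _) (continuousOn_spectrum _ _)).symm
  have hgx : cfc g H * H = msqrt H := by
    nth_rewrite 2 [← hid]
    rw [hmul, msqrt]
    congr 1
    ext x
    simp only [g]
    rw [mul_comm, ← div_eq_mul_inv, Real.div_sqrt]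
  have hsg : msqrt H * cfc g H * cfc g H = cfc g H := by
    rw [msqrt, hmul, hmul]
    congr 1
    ext x
    simp only [g]
    by_cases h : √x = 0
    · simp [h]
    · rw [mul_inv_cancel₀ h, one_mul]
  refine ⟨cfc g H * Aᴴ, by rw [mul_assoc, ← hH, hgx], ?_⟩
  rw [conjTranspose_mul, conjTranspose_conjTranspose, hg]
  calc A * cfc g H * (cfc g H * Aᴴ) * (A * cfc g H * (cfc g H * Aᴴ))
      = A * cfc g H * ((cfc g H * (Aᴴ * A)) * cfc g H * cfc g H) * Aᴴ := by
        simp only [mul_assoc]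
    _ = A * cfc g H * (cfc g H * Aᴴ) := by rw [← hH, hgx, hsg, mul_assoc]

omit [DecidableEq d] in
theorem conjTranspose_mul_self_apply (A : Matrix d d ℂ) (i : d) :
    (Aᴴ * A) i i = ((∑ j, ‖A j i‖ ^ 2 : ℝ) : ℂ) := by
  rw [Matrix.mul_apply]
  push_cast
  refine Finset.sum_congr rfl fun j _ => ?_
  rw [conjTranspose_apply]
  exact RCLike.conj_mul _

omit [DecidableEq d] in
-- Cauchy–Schwarz for the `i`-th columns of `A` and `B`.
theorem re_conjTranspose_mul_apply_le (A B : Matrix d d ℂ) (i : d) :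
    ((Aᴴ * B) i i).re ≤ √((Aᴴ * A) i i).re * √((Bᴴ * B) i i).re := by
  rw [conjTranspose_mul_self_apply, conjTranspose_mul_self_apply, Complex.ofReal_re,
    Complex.ofReal_re]
  refine le_trans ?_ (Real.sum_mul_le_sqrt_mul_sqrt _ _ _)
  rw [Matrix.mul_apply, Complex.re_sum]
  refine Finset.sum_le_sum fun j _ => (Complex.re_le_norm _).trans ?_
  simp [conjTranspose_apply]

omit [DecidableEq d] in
theorem re_apply_self_le_one {P : Matrix d d ℂ} (hP : P.IsHermitian) (h : P * P = P) (i : d) :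
    (P i i).re ≤ 1 := by
  have h1 := conjTranspose_mul_self_apply P i
  rw [hP.eq, h] at h1
  have h2 : (P i i).re = ∑ j, ‖P j i‖ ^ 2 := by rw [h1, Complex.ofReal_re]
  have h3 : ‖P i i‖ ^ 2 ≤ ∑ j, ‖P j i‖ ^ 2 :=
    Finset.single_le_sum (f := fun j => ‖P j i‖ ^ 2) (fun j _ => by positivity) (Finset.mem_univ i)
  have h4 := Complex.re_le_norm (P i i)
  nlinarith [norm_nonneg (P i i), sq_nonneg ((P i i).re - 1)]

/-- Fidelity with a state that is diagonal in some basis does not decrease when the other state is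
replaced by its diagonal in that basis. -/
theorem traceNorm_msqrt_diagConj_mul_le (U : Matrix.unitaryGroup d ℂ) {p : d → ℝ}
    {τ : Matrix d d ℂ} (hτ : τ.PosSemidef) :
    traceNorm (msqrt (diagConj U p) * msqrt τ) ≤
      ∑ i, √(p i) * √((star (U : Matrix d d ℂ) * τ * (U : Matrix d d ℂ)) i i).re := by
  obtain ⟨W, hW, hP⟩ := exists_mul_eq_msqrt (msqrt (diagConj U p) * msqrt τ)
  have hUU := Unitary.mul_star_self_of_mem U.2
  have hsτ : (msqrt τ)ᴴ = msqrt τ := isHermitian_cfc _ _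
  set V : Matrix d d ℂ := (U : Matrix d d ℂ) with hV
  set X : Matrix d d ℂ := msqrt τ * V
  set Y : Matrix d d ℂ := W * V
  have hXX : Xᴴ * X = star V * τ * V := by
    rw [conjTranspose_mul, hsτ, star_eq_conjTranspose]
    conv_rhs => rw [← msqrt_mul_self hτ]
    simp only [X, mul_assoc]
  have hXY : Xᴴ * Y = star V * (msqrt τ * W) * V := by
    rw [conjTranspose_mul, hsτ, star_eq_conjTranspose]
    simp only [Y, mul_assoc]
  have hYY : ∀ i, ((Yᴴ * Y) i i).re ≤ 1 := by
    refine re_apply_self_le_one (Matrix.isHermitian_conjTranspose_mul_self Y) ?_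
    have : Yᴴ * Y = star V * (Wᴴ * W) * V := by
      rw [conjTranspose_mul, star_eq_conjTranspose]
      simp only [Y, mul_assoc]
    rw [this]
    calc _ = star V * ((Wᴴ * W) * (V * star V) * (Wᴴ * W)) * V := by simp only [mul_assoc]
      _ = _ := by rw [hUU, mul_one, hP]
  -- By cyclicity the trace norm is `tr(√ρ √τ W)`. In the basis `U` the factor `√ρ` is diagonal, so
  -- only the diagonal of `X† Y = U† √τ W U` enters. Columnwise Cauchy–Schwarz then finishes, as `Y†
  -- Y` is a projection.
  have htr : traceNorm (msqrt (diagConj U p) * msqrt τ) = ∑ i, √(p i) * ((Xᴴ * Y) i i).re := by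
    rw [traceNorm, ← hW, Matrix.trace_mul_comm, msqrt, cfc_diagConj, ← trace_star_mul_mul U,
      ← hV, hXY]
    have : star V * (diagConj U (fun i => √(p i)) * msqrt τ * W) * V =
        (star V * diagConj U (fun i => √(p i)) * V) * (star V * (msqrt τ * W) * V) := by
      calc _ = star V * diagConj U (fun i => √(p i)) * 1 * (msqrt τ * W) * V := by
            simp only [mul_assoc, mul_one]
        _ = _ := by rw [← hUU]; simp only [mul_assoc]
    rw [this, star_mul_diagConj_mul, Matrix.trace, Complex.re_sum]
    simp [Matrix.diagonal_mul]
  rw [htr]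
  refine Finset.sum_le_sum fun i _ => mul_le_mul_of_nonneg_left ?_ (Real.sqrt_nonneg _)
  refine (re_conjTranspose_mul_apply_le X Y i).trans ?_
  rw [hXX]
  exact mul_le_of_le_one_right (Real.sqrt_nonneg _) (Real.sqrt_le_one.mpr (hYY i))

theorem traceNorm_msqrt_diagConj_mul_diagConj (U : Matrix.unitaryGroup d ℂ) {p t : d → ℝ} :
    traceNorm (msqrt (diagConj U p) * msqrt (diagConj U t)) = ∑ i, √(p i) * √(t i) := by
  rw [traceNorm, msqrt, msqrt, msqrt, cfc_diagConj, cfc_diagConj, ← map_mul,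
    (isHermitian_diagConj U _).eq, ← map_mul, cfc_diagConj, trace_diagConj,
    Complex.ofReal_re]
  refine Finset.sum_congr rfl fun i _ => ?_
  simp only [Pi.mul_apply]
  rw [Real.sqrt_mul_self (by positivity)]

theorem fidelity_eq_traceNorm {ρ : Matrix d d ℂ} (hρ : ρ.trace = 1) (τ : Matrix d d ℂ) :
    fidelity ρ τ = traceNorm (msqrt ρ * msqrt τ) := by
  simp [fidelity, hρ]

theorem one_sub_sqrt_one_sub_le {y : ℝ} (hy : 0 ≤ y) : 1 - √(1 - y) ≤ y := by
  have : 1 - y ≤ √(1 - y) := by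
    rcases le_or_gt (1 - y) 0 with h | h
    · exact h.trans (Real.sqrt_nonneg _)
    · apply Real.le_sqrt_of_sq_le
      nlinarith
  linarith

theorem half_le_one_sub_sqrt_one_sub {y : ℝ} (hy : y ≤ 1) : y / 2 ≤ 1 - √(1 - y) := by
  have : √(1 - y) ≤ 1 - y / 2 := by
    apply Real.sqrt_le_iff.mpr
    constructor
    · linarith
    · nlinarith [sq_nonneg y]
  linarith

theorem traceNorm_nonneg (A : Matrix d d ℂ) : 0 ≤ traceNorm A := by
  have hH := Matrix.isHermitian_conjTranspose_mul_self A
  obtain ⟨U, x, -, hx, -⟩ := exists_diagConj_of_commute hH hH (Commute.refl _)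
  rw [traceNorm, hx, msqrt, cfc_diagConj, trace_diagConj, Complex.ofReal_re]
  exact Finset.sum_nonneg fun i _ => Real.sqrt_nonneg _

/-- An upper bound on the success amplitude of smoothing, in terms of classical fidelities. -/
theorem one_sub_smoothingQuantity_le (U : Matrix.unitaryGroup d ℂ) {p q : d → ℝ}
    (hp : ∑ i, p i = 1) (hq : ∀ i, 0 ≤ q i) (lam : ℝ) {B : ℝ}
    (hB : ∀ t : d → ℝ, (∀ i, 0 ≤ t i) → ∑ i, t i ≤ 1 → (∀ i, t i ≤ 2 ^ lam * q i) →
      (∑ i, √(p i) * √(t i)) ^ 2 ≤ B) :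
    1 - smoothingQuantity (diagConj U p) (diagConj U q) lam ≤ B := by
  rw [sub_le_comm]
  refine le_csInf ⟨_, 0, ⟨Matrix.PosSemidef.zero, by simp⟩, ?_, rfl⟩ ?_
  · rw [sub_zero, ← map_smul, posSemidef_diagConj_iff]
    intro i
    simp only [Pi.smul_apply, smul_eq_mul]
    have := hq i
    positivity
  · rintro _ ⟨τ, ⟨hτ, htr⟩, hle, rfl⟩
    rw [purifiedDistance, fidelity_eq_traceNorm (by rw [trace_diagConj, hp]; simp)]
    have h0 := traceNorm_nonneg (msqrt (diagConj U p) * msqrt τ)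
    have h1 := traceNorm_msqrt_diagConj_mul_le U (p := p) hτ
    -- The diagonal of `U† τ U` is a feasible classical `t`: conjugation preserves the trace and
    -- both positivity constraints, which are then read on the diagonal.
    have hpsd := hτ.conjTranspose_mul_mul_same (U : Matrix d d ℂ)
    have hpsd2 := hle.conjTranspose_mul_mul_same (U : Matrix d d ℂ)
    rw [← star_eq_conjTranspose] at hpsd hpsd2
    rw [mul_sub, sub_mul, ← map_smul, star_mul_diagConj_mul] at hpsd2
    have h2 := hB (fun i => ((star (U : Matrix d d ℂ) * τ * (U : Matrix d d ℂ)) i i).re)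
      (fun i => (Complex.nonneg_iff.mp (hpsd.diag_nonneg (i := i))).1)
      (by
        rw [← Complex.re_sum]
        have := trace_star_mul_mul U τ
        rw [Matrix.trace] at this
        simp only [Matrix.diag_apply] at this
        rw [this]
        exact htr)
      (fun i => by
        have := (Complex.nonneg_iff.mp (hpsd2.diag_nonneg (i := i))).1
        simpa using this)
    have h3 := one_sub_sqrt_one_sub_le (sq_nonneg (traceNorm (msqrt (diagConj U p) * msqrt τ)))
    have h4 := pow_le_pow_left₀ h0 h1 2
    linarith

/-- Any feasible classical `t` gives a feasible diagonal `τ`. The factor `1/2` comes from `1 - √(1 -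
y) ≥ y/2` and costs nothing in the exponent. -/
theorem le_one_sub_smoothingQuantity (U : Matrix.unitaryGroup d ℂ) {p q t : d → ℝ}
    (hp0 : ∀ i, 0 ≤ p i) (hp : ∑ i, p i = 1) (lam : ℝ)
    (ht : ∀ i, 0 ≤ t i) (ht1 : ∑ i, t i ≤ 1) (htq : ∀ i, t i ≤ 2 ^ lam * q i) :
    (∑ i, √(p i) * √(t i)) ^ 2 / 2 ≤
      1 - smoothingQuantity (diagConj U p) (diagConj U q) lam := by
  have hF : ∑ i, √(p i) * √(t i) ≤ 1 := by
    have : ∀ i, √(p i) * √(t i) ≤ (p i + t i) / 2 := fun i => by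
      nlinarith [sq_nonneg (√(p i) - √(t i)), Real.sq_sqrt (hp0 i), Real.sq_sqrt (ht i)]
    calc _ ≤ ∑ i, (p i + t i) / 2 := Finset.sum_le_sum fun i _ => this i
      _ = (∑ i, p i + ∑ i, t i) / 2 := by rw [← Finset.sum_div, Finset.sum_add_distrib]
      _ ≤ 1 := by linarith
  have hF0 : 0 ≤ ∑ i, √(p i) * √(t i) := Finset.sum_nonneg fun i _ => by positivity
  have h1 : smoothingQuantity (diagConj U p) (diagConj U q) lam ≤
      purifiedDistance (diagConj U p) (diagConj U t) := by
    refine csInf_le ⟨0, ?_⟩ ⟨_, ⟨(posSemidef_diagConj_iff U t).mpr ht, ?_⟩, ?_, rfl⟩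
    · rintro _ ⟨τ, -, -, rfl⟩
      exact Real.sqrt_nonneg _
    · rw [trace_diagConj, Complex.ofReal_re]
      exact ht1
    · rw [← map_smul, ← map_sub, posSemidef_diagConj_iff]
      intro i
      simpa using htq i
  rw [purifiedDistance, fidelity_eq_traceNorm (by rw [trace_diagConj, hp]; simp),
    traceNorm_msqrt_diagConj_mul_diagConj] at h1
  have h2 := half_le_one_sub_sqrt_one_sub (pow_le_one₀ (n := 2) hF0 hF)
  linarith

theorem supp_isOrtho_iff (A B : Matrix d d ℂ) : supp A ⟂ supp B ↔ Aᴴ * B = 0 := by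
  rw [supp, supp, Submodule.isOrtho_iff_inner_eq,
    ← (Matrix.toEuclideanLin (𝕜 := ℂ) (m := d) (n := d)).map_eq_zero_iff]
  have h : ∀ x y, inner ℂ (Matrix.toEuclideanLin A x) (Matrix.toEuclideanLin B y) =
      inner ℂ x (Matrix.toEuclideanLin (Aᴴ * B) y) := fun x y => by
    have : Matrix.toEuclideanLin (Aᴴ * B) y =
        Matrix.toEuclideanLin Aᴴ (Matrix.toEuclideanLin B y) := by
      simp [Matrix.toLpLin_apply, Matrix.mulVec_mulVec]
    rw [this, Matrix.toEuclideanLin_conjTranspose_eq_adjoint, LinearMap.adjoint_inner_right]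
  constructor
  · intro H
    ext1 y
    rw [LinearMap.zero_apply, ← inner_self_eq_zero (𝕜 := ℂ), ← h]
    exact H _ ⟨_, rfl⟩ _ ⟨_, rfl⟩
  · rintro H _ ⟨x, rfl⟩ _ ⟨y, rfl⟩
    rw [h, H, LinearMap.zero_apply, inner_zero_right]

theorem supp_diagConj_isOrtho_iff (U : Matrix.unitaryGroup d ℂ) (p q : d → ℝ) :
    supp (diagConj U p) ⟂ supp (diagConj U q) ↔ ∀ i, p i * q i = 0 := by
  rw [supp_isOrtho_iff, (isHermitian_diagConj U p).eq, ← map_mul,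
    map_eq_zero_iff _ (diagConj_injective U), funext_iff]
  rfl

theorem sandwichedQ_diagConj (U : Matrix.unitaryGroup d ℂ) {p q : d → ℝ} (hp : ∀ i, 0 ≤ p i)
    (hq : ∀ i, 0 ≤ q i) {α : ℝ} (h0 : 0 < α) (h1 : α < 1) :
    sandwichedQ α (diagConj U p) (diagConj U q) = ∑ i, p i ^ α * q i ^ (1 - α) := by
  rw [sandwichedQ, mpow, mpow, cfc_diagConj, ← map_mul, ← map_mul, cfc_diagConj, trace_diagConj,
    Complex.ofReal_re]
  refine Finset.sum_congr rfl fun i _ => ?_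
  simp only [Pi.mul_apply]
  have h2 := Real.rpow_nonneg (hq i) ((1 - α) / (2 * α))
  rw [Real.mul_rpow (mul_nonneg h2 (hp i)) h2, Real.mul_rpow h2 (hp i), mul_right_comm,
    ← Real.rpow_mul (hq i), ← Real.rpow_add_of_nonneg (hq i), mul_comm]
  · congr 2
    field_simp
    ring
  all_goals
    have : 0 < 1 - α := by linarith
    positivity

end StrongConverse

/-! ### The classical exponent: Hölder bound, change of measure, saddle point. -/

namespace StrongConverse

section

variable {d : Type*} [Fintype d]

/-- Hölder with weights `t` and exponent `2α ≥ 1`, applied to `√(p/t)`; this is where `α ≥ 1/2` is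
needed. Then `t^(1-α) ≤ q^(1-α)` and `∑ t ≤ 1` remove `t`. -/
theorem sq_sum_sqrt_mul_sqrt_le {p q t : d → ℝ} (hp : ∀ i, 0 ≤ p i) (ht : ∀ i, 0 ≤ t i)
    (ht1 : ∑ i, t i ≤ 1) (htq : ∀ i, t i ≤ q i) {α : ℝ} (h0 : 1 / 2 ≤ α) (h1 : α < 1) :
    (∑ i, √(p i) * √(t i)) ^ 2 ≤ (∑ i, p i ^ α * q i ^ (1 - α)) ^ (1 / α) := by
  have hα : 0 < α := by linarith
  have h2 : 1 ≤ 2 * α := by linarith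
  have hq : ∀ i, 0 ≤ q i := fun i => (ht i).trans (htq i)
  have key := Real.inner_le_weight_mul_Lp_of_nonneg Finset.univ h2 t (fun i => √(p i / t i)) ht
    (fun i => Real.sqrt_nonneg _)
  have e1 : ∀ i, t i * √(p i / t i) = √(p i) * √(t i) := fun i => by
    rw [Real.sqrt_div (hp i)]
    rcases (ht i).eq_or_lt with h | h
    · simp [← h]
    · have := Real.sqrt_pos.mpr h
      field_simp
      rw [Real.sq_sqrt h.le, mul_comm]
  have e2 : ∀ i, t i * √(p i / t i) ^ (2 * α) ≤ p i ^ α * q i ^ (1 - α) := fun i => by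
    have hR : 0 ≤ p i ^ α * q i ^ (1 - α) :=
      mul_nonneg (Real.rpow_nonneg (hp i) _) (Real.rpow_nonneg (hq i) _)
    rcases (ht i).eq_or_lt with h | h
    · rw [← h, zero_mul]
      exact hR
    · rw [Real.rpow_mul (Real.sqrt_nonneg _), Real.rpow_two,
        Real.sq_sqrt (div_nonneg (hp i) h.le), Real.div_rpow (hp i) h.le]
      have : t i * (p i ^ α / t i ^ α) = p i ^ α * t i ^ (1 - α) := by
        rw [Real.rpow_sub h, Real.rpow_one]
        ring
      rw [this]
      exact mul_le_mul_of_nonneg_left (Real.rpow_le_rpow h.le (htq i) (by linarith))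
        (Real.rpow_nonneg (hp i) _)
  simp only [e1] at key
  have hT : (∑ i, t i) ^ (1 - (2 * α)⁻¹) ≤ 1 :=
    Real.rpow_le_one (Finset.sum_nonneg fun i _ => ht i) ht1
      (sub_nonneg.mpr (inv_le_one_of_one_le₀ h2))
  have hS : 0 ≤ ∑ i, t i * √(p i / t i) ^ (2 * α) :=
    Finset.sum_nonneg fun i _ => mul_nonneg (ht i) (Real.rpow_nonneg (Real.sqrt_nonneg _) _)
  have h3 : ∑ i, √(p i) * √(t i) ≤ (∑ i, p i ^ α * q i ^ (1 - α)) ^ (2 * α)⁻¹ := by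
    refine key.trans ((mul_le_of_le_one_left (Real.rpow_nonneg hS _) hT).trans ?_)
    exact Real.rpow_le_rpow hS (Finset.sum_le_sum fun i _ => e2 i) (by positivity)
  have hF0 : 0 ≤ ∑ i, √(p i) * √(t i) := Finset.sum_nonneg fun i _ => by positivity
  refine (pow_le_pow_left₀ hF0 h3 2).trans (le_of_eq ?_)
  rw [← Real.rpow_natCast, ← Real.rpow_mul]
  · congr 1
    push_cast
    field_simp
  · exact Finset.sum_nonneg fun i _ => mul_nonneg (Real.rpow_nonneg (hp i) _) (Real.rpow_nonneg (hq i) _)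

theorem sum_prod_eq_pow (w : d → ℝ) (n : ℕ) :
    ∑ x : Fin n → d, ∏ k, w (x k) = (∑ i, w i) ^ n := by
  classical
  have := Finset.prod_univ_sum (fun _ : Fin n => (Finset.univ : Finset d)) fun _ i => w i
  rw [Fintype.piFinset_univ] at this
  simpa using this.symm

theorem sum_prod_rpow_mul_rpow {p q : d → ℝ} (hp : ∀ i, 0 ≤ p i) (hq : ∀ i, 0 ≤ q i)
    {c : ℝ} (hc : 0 ≤ c) (a b : ℝ) (n : ℕ) :
    ∑ x : Fin n → d, (∏ k, p (x k)) ^ a * (c * ∏ k, q (x k)) ^ b =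
      c ^ b * (∑ i, p i ^ a * q i ^ b) ^ n := by
  rw [← sum_prod_eq_pow, Finset.mul_sum]
  refine Finset.sum_congr rfl fun x _ => ?_
  rw [Real.mul_rpow hc (Finset.prod_nonneg fun k _ => hq _), Finset.prod_mul_distrib,
    Real.finsetProd_rpow _ _ (fun k _ => hp _), Real.finsetProd_rpow _ _ (fun k _ => hq _)]
  ring

theorem sum_fin_succ_fun (F : ∀ {n : ℕ}, (Fin n → d) → ℝ) (n : ℕ) :
    ∑ x : Fin (n + 1) → d, F x = ∑ a, ∑ x : Fin n → d, F (Fin.cons a x : Fin (n + 1) → d) := by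
  rw [← Fintype.sum_prod_type']
  exact ((Fin.consEquiv fun _ : Fin (n + 1) => d).sum_comp fun x => F x).symm

theorem sum_prod_mul_sum {w : d → ℝ} (hw : ∑ i, w i = 1) (h : d → ℝ) (n : ℕ) :
    ∑ x : Fin n → d, (∏ k, w (x k)) * ∑ k, h (x k) = n * ∑ i, w i * h i := by
  induction n with
  | zero => simp
  | succ n ih =>
    rw [sum_fin_succ_fun fun {m} x => (∏ k, w (x k)) * ∑ k, h (x k)]
    simp only [Fin.prod_univ_succ, Fin.sum_univ_succ, Fin.cons_zero, Fin.cons_succ]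
    have : ∀ a, ∑ x : Fin n → d, w a * (∏ k, w (x k)) * (h a + ∑ k, h (x k)) =
        w a * h a + w a * (n * ∑ i, w i * h i) := fun a => by
      rw [← ih, Finset.mul_sum]
      have e : w a * h a = ∑ x : Fin n → d, w a * h a * ∏ k, w (x k) := by
        rw [← Finset.mul_sum, sum_prod_eq_pow, hw]; simp
      rw [e, ← Finset.sum_add_distrib]
      exact Finset.sum_congr rfl fun x _ => by ring
    simp only [this]
    rw [Finset.sum_add_distrib, ← Finset.sum_mul, hw]
    push_cast
    ring

theorem sum_prod_mul_sum_sq {w : d → ℝ} (hw : ∑ i, w i = 1) {h : d → ℝ}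
    (hh : ∑ i, w i * h i = 0) (n : ℕ) :
    ∑ x : Fin n → d, (∏ k, w (x k)) * (∑ k, h (x k)) ^ 2 = n * ∑ i, w i * h i ^ 2 := by
  induction n with
  | zero => simp
  | succ n ih =>
    rw [sum_fin_succ_fun fun {m} x => (∏ k, w (x k)) * (∑ k, h (x k)) ^ 2]
    simp only [Fin.prod_univ_succ, Fin.sum_univ_succ, Fin.cons_zero, Fin.cons_succ]
    have : ∀ a, ∑ x : Fin n → d, w a * (∏ k, w (x k)) * (h a + ∑ k, h (x k)) ^ 2 =
        w a * h a ^ 2 + w a * (n * ∑ i, w i * h i ^ 2) := fun a => by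
      have e : w a * h a ^ 2 = ∑ x : Fin n → d, w a * h a ^ 2 * ∏ k, w (x k) := by
        rw [← Finset.mul_sum, sum_prod_eq_pow, hw]; simp
      -- The cross term of the square vanishes because `h` has mean zero.
      have e' : 0 = ∑ x : Fin n → d, 2 * w a * h a * ((∏ k, w (x k)) * ∑ k, h (x k)) := by
        rw [← Finset.mul_sum, sum_prod_mul_sum hw, hh]; simp
      rw [← add_zero (w a * h a ^ 2 + _), ← ih, Finset.mul_sum, e, e',
        ← Finset.sum_add_distrib, ← Finset.sum_add_distrib]
      exact Finset.sum_congr rfl fun x _ => by ring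
    simp only [this]
    rw [Finset.sum_add_distrib, ← Finset.sum_mul, hw]
    push_cast
    ring

/-- A distribution `w` yields, at every blocklength, a feasible sub-distribution whose fidelity
with `p^n` decays at most with exponent `D(w‖p) + (D(w‖q) - R)⁺`, up to a square root term. -/
theorem exists_exp_le_sq_sum_sqrt {p q w : d → ℝ} (hq : ∀ i, 0 ≤ q i)
    (hw : ∀ i, 0 ≤ w i) (hw1 : ∑ i, w i = 1) (hpq : ∀ i, w i ≠ 0 → 0 < p i ∧ 0 < q i)
    (R : ℝ) {Dp Dq V : ℝ} (hDp : ∑ i, w i * (Real.log (w i) - Real.log (p i)) = Dp)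
    (hDq : ∑ i, w i * (Real.log (w i) - Real.log (q i)) = Dq)
    (hV : ∑ i, w i * (Real.log (w i) - Real.log (q i) - Dq) ^ 2 = V) (n : ℕ) :
    ∃ t : (Fin n → d) → ℝ, (∀ x, 0 ≤ t x) ∧ ∑ x, t x ≤ 1 ∧
      (∀ x, t x ≤ Real.exp (n * R) * ∏ k, q (x k)) ∧
      Real.exp (-(n * (Dp + max (Dq - R) 0) + √(n * V))) ≤
        (∑ x, √(∏ k, p (x k)) * √(t x)) ^ 2 := by
  set W : (Fin n → d) → ℝ := fun x => ∏ k, w (x k) with hWdef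
  have hW0 : ∀ x, 0 ≤ W x := fun x => Finset.prod_nonneg fun k _ => hw _
  have hW1 : ∑ x, W x = 1 := by rw [hWdef, sum_prod_eq_pow, hw1, one_pow]
  set A : (Fin n → d) → ℝ := fun x => ∑ k, (Real.log (w (x k)) - Real.log (p (x k)))
  set B : (Fin n → d) → ℝ := fun x => ∑ k, (Real.log (w (x k)) - Real.log (q (x k)))
  set M : (Fin n → d) → ℝ := fun x => max (B x - n * R) 0
  have hQ0 : ∀ x : Fin n → d, 0 ≤ Real.exp (n * R) * ∏ k, q (x k) := fun x =>
    mul_nonneg (Real.exp_nonneg _) (Finset.prod_nonneg fun k _ => hq _)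
  refine ⟨fun x => min (W x) (Real.exp (n * R) * ∏ k, q (x k)), fun x => le_min (hW0 x) (hQ0 x),
    (Finset.sum_le_sum fun x _ => min_le_left _ _).trans hW1.le, fun x => min_le_right _ _, ?_⟩
  -- On the support of `W`, `p^n = W e^(-A)` and the minimum is `W e^(-M)`, so the summand equals
  -- the left side. This makes the sum a `W`-average of exponentials, ready for Jensen.
  have hterm : ∀ x, W x * Real.exp (-(A x + M x) / 2) ≤
      √(∏ k, p (x k)) * √(min (W x) (Real.exp (n * R) * ∏ k, q (x k))) := fun x => by
    rcases (hW0 x).eq_or_lt with h | h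
    · rw [← h, zero_mul]; positivity
    have hne : ∀ k, w (x k) ≠ 0 := fun k => Finset.prod_ne_zero_iff.mp h.ne' k (Finset.mem_univ k)
    have hratio : ∀ u : d → ℝ, (∀ i, w i ≠ 0 → 0 < u i) → ∏ k, u (x k) =
        W x * Real.exp (-∑ k, (Real.log (w (x k)) - Real.log (u (x k)))) := fun u hu => by
      rw [← Finset.sum_neg_distrib, Real.exp_sum, ← Finset.prod_mul_distrib]
      refine Finset.prod_congr rfl fun k _ => ?_
      rw [neg_sub, Real.exp_sub, Real.exp_log (hu _ (hne k)),
        Real.exp_log ((hw _).lt_of_ne' (hne k)), mul_div_cancel₀ _ (hne k)]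
    have hmin : min (W x) (Real.exp (n * R) * ∏ k, q (x k)) = W x * Real.exp (-M x) := by
      rw [hratio q fun i hi => (hpq i hi).2, mul_left_comm, ← Real.exp_add]
      have : -M x = min 0 (n * R + -B x) := by
        simp only [M]
        rw [← min_neg_neg, min_comm]
        congr 1 <;> ring
      rw [this, Real.exp_monotone.map_min, mul_min_of_nonneg _ _ h.le, Real.exp_zero, mul_one]
    rw [hmin, hratio p fun i hi => (hpq i hi).1, ← Real.sqrt_mul (by positivity)]
    refine Real.le_sqrt_of_sq_le (le_of_eq ?_)
    rw [mul_pow, ← Real.exp_nat_mul]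
    have : ((2 : ℕ) : ℝ) * (-(A x + M x) / 2) = -A x + -M x := by push_cast; ring
    rw [this, Real.exp_add]
    ring
  have hjensen : Real.exp (∑ x, W x * (-(A x + M x) / 2)) ≤
      ∑ x, √(∏ k, p (x k)) * √(min (W x) (Real.exp (n * R) * ∏ k, q (x k))) := by
    have := convexOn_exp.map_sum_le (t := Finset.univ) (w := W)
      (p := fun x => -(A x + M x) / 2) (fun x _ => hW0 x) hW1 (fun x _ => Set.mem_univ _)
    simp only [smul_eq_mul] at this
    exact this.trans (Finset.sum_le_sum fun x _ => hterm x)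
  refine le_trans ?_ (pow_le_pow_left₀ (Real.exp_nonneg _) hjensen 2)
  rw [← Real.exp_nat_mul, Real.exp_le_exp]
  have hA : ∑ x, W x * A x = n * Dp := by
    rw [← hDp]
    exact sum_prod_mul_sum hw1 (fun i => Real.log (w i) - Real.log (p i)) n
  have hB2 : ∑ x, W x * |B x - n * Dq| ^ 2 = n * V := by
    rw [← hV, ← sum_prod_mul_sum_sq hw1 (h := fun i => Real.log (w i) - Real.log (q i) - Dq)]
    · refine Finset.sum_congr rfl fun x _ => ?_
      rw [sq_abs]
      simp [B, Finset.sum_sub_distrib, hWdef]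
    · simp only [mul_sub _ _ Dq]
      rw [Finset.sum_sub_distrib, ← Finset.sum_mul, hw1, hDq, one_mul, sub_self]
  have hB1 : ∑ x, W x * |B x - n * Dq| ≤ √(n * V) := by
    rw [← hB2]
    exact Real.le_sqrt_of_sq_le (Real.pow_arith_mean_le_arith_mean_pow _ W _
      (fun x _ => hW0 x) hW1 (fun x _ => abs_nonneg _) 2)
  have hM : ∑ x, W x * M x ≤ n * max (Dq - R) 0 + √(n * V) := by
    -- The positive part of `B - nR` exceeds `n (Dq - R)⁺` by at most the deviation of `B` from its
    -- mean `n Dq`, whose average is at most the standard deviation `√(nV)`.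
    have h1 : ∀ x, M x ≤ n * max (Dq - R) 0 + |B x - n * Dq| := fun x => by
      have h2 : (n : ℝ) * (Dq - R) ≤ n * max (Dq - R) 0 :=
        mul_le_mul_of_nonneg_left (le_max_left _ _) n.cast_nonneg
      have h3 : 0 ≤ (n : ℝ) * max (Dq - R) 0 := mul_nonneg n.cast_nonneg (le_max_right _ _)
      have h4 := le_abs_self (B x - n * Dq)
      have h5 := abs_nonneg (B x - n * Dq)
      refine max_le ?_ ?_ <;> linarith
    calc ∑ x, W x * M x ≤ ∑ x, W x * (n * max (Dq - R) 0 + |B x - n * Dq|) :=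
          Finset.sum_le_sum fun x _ => mul_le_mul_of_nonneg_left (h1 x) (hW0 x)
      _ = n * max (Dq - R) 0 + ∑ x, W x * |B x - n * Dq| := by
          simp only [mul_add]
          rw [Finset.sum_add_distrib, ← Finset.sum_mul, hW1, one_mul]
      _ ≤ _ := by linarith
  have hsum : ∑ x, W x * (-(A x + M x) / 2) = -(∑ x, W x * A x + ∑ x, W x * M x) / 2 := by
    rw [← Finset.sum_add_distrib, ← Finset.sum_neg_distrib, Finset.sum_div]
    exact Finset.sum_congr rfl fun x _ => by ring
  rw [hsum, hA]
  push_cast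
  linarith

/-- The optimal exponent, as a function of `s = (1 - α) / α`. -/
noncomputable def expRate (S : Finset d) (a b : d → ℝ) (R s : ℝ) : ℝ :=
  -(1 + s) * Real.log (∑ i ∈ S, Real.exp ((a i + s * b i) / (1 + s))) - s * R

omit [Fintype d] in
theorem hasDerivAt_expRate {S : Finset d} (hS : S.Nonempty) (a b : d → ℝ) (R : ℝ) {s : ℝ}
    (hs : 0 ≤ s) :
    HasDerivAt (expRate S a b R)
      (-Real.log (∑ i ∈ S, Real.exp ((a i + s * b i) / (1 + s))) -
        (1 + s) * ((∑ i ∈ S, Real.exp ((a i + s * b i) / (1 + s)) * ((b i - a i) / (1 + s) ^ 2)) /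
          ∑ i ∈ S, Real.exp ((a i + s * b i) / (1 + s))) - R) s := by
  have hs1 : 1 + s ≠ 0 := by positivity
  have hZ : ∑ i ∈ S, Real.exp ((a i + s * b i) / (1 + s)) ≠ 0 :=
    (Finset.sum_pos (fun i _ => Real.exp_pos _) hS).ne'
  have h1 : HasDerivAt (fun s : ℝ => 1 + s) 1 s := (hasDerivAt_id s).const_add 1
  have h2 : ∀ i ∈ S, HasDerivAt (fun s : ℝ => Real.exp ((a i + s * b i) / (1 + s)))
      (Real.exp ((a i + s * b i) / (1 + s)) * ((b i - a i) / (1 + s) ^ 2)) s := fun i _ => by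
    have h3 : HasDerivAt (fun s : ℝ => a i + s * b i) (1 * b i) s :=
      ((hasDerivAt_id s).mul_const (b i)).const_add (a i)
    convert (h3.fun_div h1 hs1).exp using 2
    ring
  have h4 := (HasDerivAt.fun_sum h2).log hZ
  have h5 := (h1.neg.mul h4).sub ((hasDerivAt_id s).mul_const R)
  refine h5.congr_deriv ?_
  simp only [Pi.neg_apply]
  ring

omit [Fintype d] in
theorem exists_isMaxOn_expRate {S : Finset d} (hS : S.Nonempty) (a b : d → ℝ) (R : ℝ) :
    ∃ s ∈ Set.Icc (0 : ℝ) 1, ∃ v : d → ℝ, (∀ i, 0 < v i) ∧ ∑ i ∈ S, v i = 1 ∧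
      ∑ i ∈ S, v i * (Real.log (v i) - a i) +
        max (∑ i ∈ S, v i * (Real.log (v i) - b i) - R) 0 = expRate S a b R s := by
  have hcont : ContinuousOn (expRate S a b R) (Set.Icc 0 1) := fun s hs =>
    (hasDerivAt_expRate hS a b R hs.1).continuousAt.continuousWithinAt
  obtain ⟨s, hs, hmax⟩ := isCompact_Icc.exists_isMaxOn (Set.nonempty_Icc.mpr zero_le_one) hcont
  have hder := hasDerivAt_expRate hS a b R hs.1
  set Z := ∑ i ∈ S, Real.exp ((a i + s * b i) / (1 + s)) with hZdef
  have hZ : 0 < Z := Finset.sum_pos (fun i _ => Real.exp_pos _) hS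
  have hs1 : 0 < 1 + s := by linarith [hs.1]
  refine ⟨s, hs, fun i => Real.exp ((a i + s * b i) / (1 + s)) / Z, fun i => by positivity,
    by rw [← Finset.sum_div, div_self hZ.ne'], ?_⟩
  set v : d → ℝ := fun i => Real.exp ((a i + s * b i) / (1 + s)) / Z with hv
  have hv1 : ∑ i ∈ S, v i = 1 := by rw [hv, ← Finset.sum_div, div_self hZ.ne']
  have hlog : ∀ i, Real.log (v i) = (a i + s * b i) / (1 + s) - Real.log Z := fun i => by
    rw [hv, Real.log_div (Real.exp_pos _).ne' hZ.ne', Real.log_exp]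
  set m := ∑ i ∈ S, v i * (b i - a i) with hm
  have hL : Real.log Z = ∑ i ∈ S, v i * Real.log Z := by rw [← Finset.sum_mul, hv1, one_mul]
  have hDa : ∑ i ∈ S, v i * (Real.log (v i) - a i) = s / (1 + s) * m - Real.log Z := by
    conv_rhs => rw [hL, hm, Finset.mul_sum, ← Finset.sum_sub_distrib]
    refine Finset.sum_congr rfl fun i _ => ?_
    rw [hlog]
    generalize v i = vi
    field_simp
    ring
  have hDb : ∑ i ∈ S, v i * (Real.log (v i) - b i) = -1 / (1 + s) * m - Real.log Z := by
    conv_rhs => rw [hL, hm, Finset.mul_sum, ← Finset.sum_sub_distrib]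
    refine Finset.sum_congr rfl fun i _ => ?_
    rw [hlog]
    generalize v i = vi
    field_simp
    ring
  -- By the envelope principle, `D = ∑ v (log v - b) - R` is the derivative of `expRate` at `s`.
  set D := -1 / (1 + s) * m - Real.log Z - R with hD
  have hder' : HasDerivAt (expRate S a b R) D s := by
    convert hder using 1
    have : (∑ i ∈ S, Real.exp ((a i + s * b i) / (1 + s)) * ((b i - a i) / (1 + s) ^ 2)) / Z =
        m / (1 + s) ^ 2 := by
      rw [hm, Finset.sum_div, Finset.sum_div]
      exact Finset.sum_congr rfl fun i _ => by rw [hv]; ring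
    rw [this, hD]
    field_simp
    ring
  have hslope : ∀ y ∈ Set.Icc (0 : ℝ) 1, D * (y - s) ≤ 0 := fun y hy => by
    have h1 := (hmax.localize).hasFDerivWithinAt_nonpos hder'.hasFDerivAt.hasFDerivWithinAt
      (sub_mem_posTangentConeAt_of_segment_subset ((convex_Icc (0 : ℝ) 1).segment_subset hs hy))
    simpa [mul_comm] using h1
  have h0 := hslope 0 ⟨le_rfl, zero_le_one⟩
  have h1 := hslope 1 ⟨zero_le_one, le_rfl⟩
  -- Complementary slackness: a negative slope forces the maximizer to `s = 0`, a positive one to `s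
  -- = 1`.
  have hmaxD : max D 0 = s * D := by
    rcases lt_trichotomy D 0 with h | h | h
    · have : s = 0 := le_antisymm (by nlinarith) hs.1
      rw [max_eq_right h.le, this, zero_mul]
    · simp [h]
    · have : s = 1 := le_antisymm hs.2 (by nlinarith)
      rw [max_eq_left h.le, this, one_mul]
  rw [hDa, hDb, ← hD, hmaxD, hD, expRate, ← hZdef]
  field_simp
  ring

end

end StrongConverse

/-! ### Base-2 logarithms, extended reals and the single-letter bounds. -/

namespace StrongConverse

theorem le_neg_inv_mul_elog2 {n : ℕ} (hn : 0 < n) {y c : ℝ}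
    (h : y ≤ Real.exp (-(n * (c * Real.log 2)))) :
    (c : EReal) ≤ ((-1 / (n : ℝ) : ℝ) : EReal) * elog2 y := by
  have hn' : (0 : ℝ) < n := by exact_mod_cast hn
  have hneg : -1 / (n : ℝ) < 0 := div_neg_of_neg_of_pos (by norm_num) hn'
  rw [elog2]
  split_ifs with h0
  · rw [EReal.coe_mul_bot_of_neg hneg]
    exact le_top
  · push Not at h0
    rw [← EReal.coe_mul, EReal.coe_le_coe_iff, Real.logb]
    have h1 := Real.log_le_log h0 h
    rw [Real.log_exp] at h1
    have h2 : 0 < Real.log 2 := Real.log_pos (by norm_num)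
    rw [div_mul_div_comm, le_div_iff₀ (by positivity)]
    linarith

theorem neg_inv_mul_elog2_le {n : ℕ} (hn : 0 < n) {y c : ℝ}
    (h : Real.exp (-(n * (c * Real.log 2))) ≤ y) :
    ((-1 / (n : ℝ) : ℝ) : EReal) * elog2 y ≤ (c : EReal) := by
  have hn' : (0 : ℝ) < n := by exact_mod_cast hn
  have hy := (Real.exp_pos _).trans_le h
  rw [elog2, if_neg hy.not_ge, ← EReal.coe_mul, EReal.coe_le_coe_iff, Real.logb]
  have h1 := Real.log_le_log (Real.exp_pos _) h
  rw [Real.log_exp] at h1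
  have h2 : 0 < Real.log 2 := Real.log_pos (by norm_num)
  rw [div_mul_div_comm, div_le_iff₀ (by positivity)]
  linarith

section

variable {d : Type*} [Fintype d]

/-- The joint support of two nonnegative weights. -/
noncomputable def jointSupport (p q : d → ℝ) : Finset d :=
  Finset.univ.filter fun i => 0 < p i * q i

theorem mem_jointSupport {p q : d → ℝ} (hp : ∀ i, 0 ≤ p i) (hq : ∀ i, 0 ≤ q i) {i : d} :
    i ∈ jointSupport p q ↔ 0 < p i ∧ 0 < q i := by
  simp only [jointSupport, Finset.mem_filter, Finset.mem_univ, true_and]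
  constructor
  · intro h
    exact ⟨(hp i).lt_of_ne fun h0 => by simp [← h0] at h,
      (hq i).lt_of_ne fun h0 => by simp [← h0] at h⟩
  · exact fun h => mul_pos h.1 h.2

/-- With `s = (1-α)/α` one has `1/(1+s) = α` and `s/(1+s) = 1-α`. Indices off the joint support
contribute zero because both exponents are positive. -/
theorem sum_rpow_mul_rpow_eq {p q : d → ℝ} (hp : ∀ i, 0 ≤ p i) (hq : ∀ i, 0 ≤ q i) {α : ℝ}
    (h0 : 0 < α) (h1 : α < 1) :
    ∑ i, p i ^ α * q i ^ (1 - α) = ∑ i ∈ jointSupport p q,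
      Real.exp ((Real.log (p i) + (1 - α) / α * Real.log (q i)) / (1 + (1 - α) / α)) := by
  classical
  symm
  refine Finset.sum_subset_zero_on_sdiff (Finset.subset_univ _) (fun i hi => ?_) fun i hi => ?_
  · have := (mem_jointSupport hp hq).not.mp (Finset.mem_sdiff.mp hi).2
    rcases (hp i).eq_or_lt with h | h
    · rw [← h, Real.zero_rpow h0.ne', zero_mul]
    · rcases (hq i).eq_or_lt with h' | h'
      · rw [← h', Real.zero_rpow (by linarith), mul_zero]
      · exact absurd ⟨h, h'⟩ this
  · obtain ⟨h, h'⟩ := (mem_jointSupport hp hq).mp hi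
    rw [Real.rpow_def_of_pos h, Real.rpow_def_of_pos h', ← Real.exp_add]
    congr 1
    field_simp
    ring

/-- The exponent of the classical problem, in bits. -/
noncomputable def bitRate (p q : d → ℝ) (r s : ℝ) : ℝ :=
  expRate (jointSupport p q) (fun i => Real.log (p i)) (fun i => Real.log (q i))
    (r * Real.log 2) s / Real.log 2

theorem bitRate_mul_log_two {p q : d → ℝ} (hp : ∀ i, 0 ≤ p i) (hq : ∀ i, 0 ≤ q i) {α : ℝ}
    (h0 : 0 < α) (h1 : α < 1) (r : ℝ) :
    bitRate p q r ((1 - α) / α) * Real.log 2 =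
      -(1 / α) * Real.log (∑ i, p i ^ α * q i ^ (1 - α)) - (1 - α) / α * (r * Real.log 2) := by
  have h2 : Real.log 2 ≠ 0 := (Real.log_pos (by norm_num)).ne'
  rw [bitRate, div_mul_cancel₀ _ h2, expRate, ← sum_rpow_mul_rpow_eq hp hq h0 h1]
  congr 2
  field_simp
  ring

theorem sum_rpow_mul_rpow_pos {p q : d → ℝ} (hp : ∀ i, 0 ≤ p i) (hq : ∀ i, 0 ≤ q i)
    (hS : (jointSupport p q).Nonempty) {α : ℝ} (h0 : 0 < α) (h1 : α < 1) :
    0 < ∑ i, p i ^ α * q i ^ (1 - α) := by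
  rw [sum_rpow_mul_rpow_eq hp hq h0 h1]
  exact Finset.sum_pos (fun i _ => Real.exp_pos _) hS

variable [DecidableEq d]

theorem mul_sandwichedRenyi_diagConj_sub (U : Matrix.unitaryGroup d ℂ) {p q : d → ℝ}
    (hp : ∀ i, 0 ≤ p i) (hq : ∀ i, 0 ≤ q i) (hS : (jointSupport p q).Nonempty) {α : ℝ}
    (h0 : 0 < α) (h1 : α < 1) (r : ℝ) :
    (((1 - α) / α : ℝ) : EReal) *
        (sandwichedRenyi α (diagConj U p) (diagConj U q) - (r : EReal)) =
      (bitRate p q r ((1 - α) / α) : EReal) := by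
  have hno : ¬ (supp (diagConj U p) ⟂ supp (diagConj U q)) := by
    rw [supp_diagConj_isOrtho_iff]
    obtain ⟨i, hi⟩ := hS
    obtain ⟨h, h'⟩ := (mem_jointSupport hp hq).mp hi
    exact fun H => (mul_pos h h').ne' (H i)
  rw [sandwichedRenyi, if_pos (Or.inr ⟨h0, h1, hno⟩), ← EReal.coe_sub, ← EReal.coe_mul,
    EReal.coe_eq_coe_iff, sandwichedQ_diagConj U hp hq h0 h1]
  have h2 : Real.log 2 ≠ 0 := (Real.log_pos (by norm_num)).ne'
  have h3 : α - 1 ≠ 0 := by linarith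
  refine mul_right_cancel₀ h2 ?_
  rw [bitRate_mul_log_two hp hq h0 h1, Real.logb]
  field_simp
  ring

theorem one_sub_smoothingQuantity_tensorPower_le (U : Matrix.unitaryGroup d ℂ) {p q : d → ℝ}
    (hp : ∀ i, 0 ≤ p i) (hp1 : ∑ i, p i = 1) (hq : ∀ i, 0 ≤ q i)
    (hS : (jointSupport p q).Nonempty) {α : ℝ} (h0 : 1 / 2 ≤ α) (h1 : α < 1) (r : ℝ) (n : ℕ) :
    1 - smoothingQuantity (tensorPower (diagConj U p) n) (tensorPower (diagConj U q) n) (n * r) ≤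
      Real.exp (-(n * (bitRate p q r ((1 - α) / α) * Real.log 2))) := by
  have hα : 0 < α := by linarith
  rw [tensorPower_diagConj, tensorPower_diagConj]
  refine one_sub_smoothingQuantity_le _ (by rw [sum_prod_eq_pow, hp1, one_pow])
    (fun x => Finset.prod_nonneg fun k _ => hq _) _ fun t ht ht1 htq => ?_
  refine (sq_sum_sqrt_mul_sqrt_le (fun x => Finset.prod_nonneg fun k _ => hp _) ht ht1 htq h0
    h1).trans (le_of_eq ?_)
  have hK := sum_rpow_mul_rpow_pos hp hq hS hα h1
  rw [sum_prod_rpow_mul_rpow hp hq (by positivity), bitRate_mul_log_two hp hq hα h1]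
  generalize ∑ i, p i ^ α * q i ^ (1 - α) = K at hK ⊢
  rw [Real.rpow_def_of_pos two_pos]
  nth_rewrite 1 [← Real.exp_log hK]
  rw [← Real.exp_mul, ← Real.exp_nat_mul, ← Real.exp_add, ← Real.exp_mul]
  congr 1
  field_simp
  ring

theorem exists_exp_le_one_sub_smoothingQuantity_tensorPower (U : Matrix.unitaryGroup d ℂ)
    {p q : d → ℝ} (hp : ∀ i, 0 ≤ p i) (hp1 : ∑ i, p i = 1) (hq : ∀ i, 0 ≤ q i)
    (hS : (jointSupport p q).Nonempty) (r : ℝ) :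
    ∃ s ∈ Set.Icc (0 : ℝ) 1, ∃ V : ℝ, ∀ n : ℕ,
      Real.exp (-(n * (bitRate p q r s * Real.log 2) + √(n * V))) / 2 ≤
        1 - smoothingQuantity (tensorPower (diagConj U p) n) (tensorPower (diagConj U q) n)
          (n * r) := by
  obtain ⟨s, hs, v, hv, hv1, hvE⟩ := exists_isMaxOn_expRate hS (fun i => Real.log (p i))
    (fun i => Real.log (q i)) (r * Real.log 2)
  set S := jointSupport p q with hSdef
  -- Extending the optimal weights by zero gives a distribution on all of `d`; the entropy sums are
  -- unchanged.
  let w : d → ℝ := fun i => if i ∈ S then v i else 0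
  have hsum : ∀ u : d → ℝ, ∑ i, w i * (Real.log (w i) - u i) =
      ∑ i ∈ S, v i * (Real.log (v i) - u i) := fun u => by
    rw [← Finset.sum_filter_add_sum_filter_not Finset.univ (· ∈ S)]
    simp only [Finset.filter_mem_eq_inter, Finset.univ_inter]
    rw [Finset.sum_eq_zero (s := Finset.univ.filter (· ∉ S)), add_zero]
    · exact Finset.sum_congr rfl fun i hi => by simp [w, hi]
    · intro i hi
      simp [w, (Finset.mem_filter.mp hi).2]
  refine ⟨s, hs, ∑ i, w i * (Real.log (w i) - Real.log (q i) -
    ∑ i ∈ S, v i * (Real.log (v i) - Real.log (q i))) ^ 2, fun n => ?_⟩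
  obtain ⟨t, ht, ht1, htq, hle⟩ := exists_exp_le_sq_sum_sqrt (p := p) hq (w := w)
    (fun i => by simp only [w]; split_ifs <;> [exact (hv i).le; rfl])
    (by simp [w, hv1])
    (fun i hi => (mem_jointSupport hp hq).mp (by
      by_contra h
      exact hi (by simp [w, hSdef, h])))
    (r * Real.log 2) (hsum _) (hsum _) rfl n
  rw [hvE] at hle
  have h2 : Real.log 2 ≠ 0 := (Real.log_pos (by norm_num)).ne'
  rw [tensorPower_diagConj, tensorPower_diagConj]
  refine le_trans ?_ (le_one_sub_smoothingQuantity (t := t) _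
    (fun x => Finset.prod_nonneg fun k _ => hp _) (by rw [sum_prod_eq_pow, hp1, one_pow]) _ ht ht1
    fun x => ?_)
  · rw [bitRate, div_mul_cancel₀ _ h2]
    exact div_le_div_of_nonneg_right hle (by norm_num)
  · rw [Real.rpow_def_of_pos two_pos]
    convert htq x using 3
    ring

theorem smoothingQuantity_tensorPower_of_disjoint (U : Matrix.unitaryGroup d ℂ)
    {p q : d → ℝ} (hp1 : ∑ i, p i = 1) (hq : ∀ i, 0 ≤ q i)
    (h : ∀ i, p i * q i = 0) (lam : ℝ) {n : ℕ} (hn : 0 < n) :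
    1 - smoothingQuantity (tensorPower (diagConj U p) n) (tensorPower (diagConj U q) n) lam ≤
      0 := by
  rw [tensorPower_diagConj, tensorPower_diagConj]
  refine one_sub_smoothingQuantity_le _ (by rw [sum_prod_eq_pow, hp1, one_pow])
    (fun x => Finset.prod_nonneg fun k _ => hq _) _ fun t ht _ htq => le_of_eq ?_
  rw [Finset.sum_eq_zero, zero_pow two_ne_zero]
  intro x _
  have : (∏ k, p (x k)) * ∏ k, q (x k) = 0 := by
    rw [← Finset.prod_mul_distrib]
    exact Finset.prod_eq_zero (Finset.mem_univ ⟨0, hn⟩) (h _)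
  rcases mul_eq_zero.mp this with h0 | h0
  · rw [h0, Real.sqrt_zero, zero_mul]
  · have : t x = 0 := le_antisymm (by simpa [h0] using htq x) (ht x)
    rw [this, Real.sqrt_zero, mul_zero]

end

end StrongConverse

theorem mainTheorem5 {d : Type*} [Fintype d] [DecidableEq d]
    (ρ σ : Matrix d d ℂ) (hρ : StrongConverse.IsState ρ) (hσ : σ.PosSemidef)
    (hcomm : Commute ρ σ) (r : ℝ) :
    Filter.Tendsto
      (fun n : ℕ => ((-1 / (n : ℝ) : ℝ) : EReal) *
        StrongConverse.elog2 (1 - StrongConverse.smoothingQuantity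
          (StrongConverse.tensorPower ρ n) (StrongConverse.tensorPower σ n) ((n : ℝ) * r)))
      Filter.atTop
      (nhds (⨆ α ∈ Set.Ico (1 / 2 : ℝ) 1,
        (((1 - α) / α : ℝ) : EReal) *
          (StrongConverse.sandwichedRenyi α ρ σ - (r : EReal)))) := by
  open StrongConverse in
  obtain ⟨hρ0, hρ1⟩ := hρ
  obtain ⟨U, p, q, rfl, rfl⟩ := exists_diagConj_of_commute hρ0.isHermitian hσ.isHermitian hcomm
  have hp := (posSemidef_diagConj_iff U p).mp hρ0
  have hq := (posSemidef_diagConj_iff U q).mp hσ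
  have hp1 : ∑ i, p i = 1 := by
    rw [trace_diagConj] at hρ1
    exact_mod_cast hρ1
  by_cases hS : (jointSupport p q).Nonempty
  · obtain ⟨s, hs, V, hV⟩ := exists_exp_le_one_sub_smoothingQuantity_tensorPower U hp hp1 hq hS r
    have hlog2 : 0 < Real.log 2 := Real.log_pos (by norm_num)
    set E := ⨆ α ∈ Set.Ico (1 / 2 : ℝ) 1, (((1 - α) / α : ℝ) : EReal) *
      (sandwichedRenyi α (diagConj U p) (diagConj U q) - (r : EReal)) with hE
    have hlow : ∀ n : ℕ, 0 < n → E ≤ ((-1 / (n : ℝ) : ℝ) : EReal) * elog2 (1 - smoothingQuantity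
        (tensorPower (diagConj U p) n) (tensorPower (diagConj U q) n) (n * r)) := fun n hn => by
      refine iSup₂_le fun α hα => ?_
      rw [mul_sandwichedRenyi_diagConj_sub U hp hq hS (by linarith [hα.1]) hα.2]
      exact le_neg_inv_mul_elog2 hn
        (one_sub_smoothingQuantity_tensorPower_le U hp hp1 hq hS hα.1 hα.2 r n)
    -- The `1/√n` term comes from the standard deviation, the `1/n` term from the factor `1/2`.
    have hupp : ∀ n : ℕ, 0 < n → ((-1 / (n : ℝ) : ℝ) : EReal) * elog2 (1 - smoothingQuantity
        (tensorPower (diagConj U p) n) (tensorPower (diagConj U q) n) (n * r)) ≤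
        ((bitRate p q r s + √V / Real.log 2 * (√(n : ℝ))⁻¹ + (n : ℝ)⁻¹ : ℝ) : EReal) :=
        fun n hn => by
      refine neg_inv_mul_elog2_le hn (le_trans (le_of_eq ?_) (hV n))
      have hn' : (0 : ℝ) < n := by exact_mod_cast hn
      have hhalf : ∀ x : ℝ, Real.exp x / 2 = Real.exp (x - Real.log 2) := fun x => by
        rw [Real.exp_sub, Real.exp_log two_pos]
      rw [hhalf, Real.sqrt_mul hn'.le, ← Real.sqrt_div_self]
      congr 1
      field_simp
      ring
    have hlim : Filter.Tendsto (fun n : ℕ =>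
        ((bitRate p q r s + √V / Real.log 2 * (√(n : ℝ))⁻¹ + (n : ℝ)⁻¹ : ℝ) : EReal))
        Filter.atTop (nhds (bitRate p q r s : EReal)) := by
      refine (continuous_coe_real_ereal.tendsto _).comp ?_
      have h1 : Filter.Tendsto (fun n : ℕ => (√(n : ℝ))⁻¹) Filter.atTop (nhds 0) :=
        (Real.tendsto_sqrt_atTop.comp tendsto_natCast_atTop_atTop).inv_tendsto_atTop
      have h2 : Filter.Tendsto (fun n : ℕ => (n : ℝ)⁻¹) Filter.atTop (nhds 0) :=
        tendsto_natCast_atTop_atTop.inv_tendsto_atTop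
      simpa using ((h1.const_mul (√V / Real.log 2)).const_add (bitRate p q r s)).add h2
    have hle : ∀ u : ℝ, 0 < u → u ≤ 1 → (bitRate p q r u : EReal) ≤ E := fun u hu0 hu1 => by
      have hα : 1 / (1 + u) ∈ Set.Ico (1 / 2 : ℝ) 1 := by
        constructor
        · exact one_div_le_one_div_of_le (by linarith) (by linarith)
        · rw [div_lt_one (by linarith)]
          linarith
      have hu : (1 - 1 / (1 + u)) / (1 / (1 + u)) = u := by
        field_simp
        ring
      have h1 := mul_sandwichedRenyi_diagConj_sub U hp hq hS (by linarith [hα.1]) hα.2 r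
      rw [hu] at h1
      rw [← h1]
      nth_rewrite 1 [← hu]
      exact le_iSup₂_of_le _ hα le_rfl
    -- The value `s = 0` corresponds to the excluded `α = 1`; it is reached by continuity as `u →
    -- 0⁺`.
    have hsE : (bitRate p q r s : EReal) ≤ E := by
      rcases hs.1.eq_or_lt with h0 | h0
      · rw [← h0]
        have hc : ContinuousAt (bitRate p q r) 0 :=
          (hasDerivAt_expRate hS _ _ _ le_rfl).continuousAt.div_const _
        have ht : Filter.Tendsto (fun u => (bitRate p q r u : EReal)) (nhdsWithin 0 (Set.Ioi 0))
            (nhds (bitRate p q r 0 : EReal)) :=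
          (continuous_coe_real_ereal.tendsto _).comp (hc.tendsto.mono_left nhdsWithin_le_nhds)
        refine le_of_tendsto ht ?_
        filter_upwards [Ioc_mem_nhdsGT (zero_lt_one' ℝ)] with u hu
        exact hle u hu.1 hu.2
      · exact hle s h0 hs.2
    -- Optimality of `s` follows from comparing the two bounds on the same sequence, so the
    -- maximality of `expRate` at `s` need not be carried along.
    have hEs : E ≤ (bitRate p q r s : EReal) := by
      refine ge_of_tendsto hlim ?_
      filter_upwards [Filter.eventually_gt_atTop 0] with n hn
      exact (hlow n hn).trans (hupp n hn)
    refine tendsto_of_tendsto_of_tendsto_of_le_of_le' tendsto_const_nhds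
      (le_antisymm hsE hEs ▸ hlim) ?_ ?_
    · filter_upwards [Filter.eventually_gt_atTop 0] with n hn using hlow n hn
    · filter_upwards [Filter.eventually_gt_atTop 0] with n hn using hupp n hn
  · have hdisj : ∀ i, p i * q i = 0 := fun i => by
      by_contra h
      refine hS ⟨i, (mem_jointSupport hp hq).mpr ⟨?_, ?_⟩⟩
      · exact (hp i).lt_of_ne' (left_ne_zero_of_mul h)
      · exact (hq i).lt_of_ne' (right_ne_zero_of_mul h)
    have hperp := (supp_diagConj_isOrtho_iff U p q).mpr hdisj
    have htop : (⨆ α ∈ Set.Ico (1 / 2 : ℝ) 1, (((1 - α) / α : ℝ) : EReal) *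
        (sandwichedRenyi α (diagConj U p) (diagConj U q) - (r : EReal))) = ⊤ := by
      -- At `α = 1/2` the prefactor is `1`, so this single term is already `⊤`.
      refine top_le_iff.mp (le_iSup₂_of_le (1 / 2) ⟨le_rfl, by norm_num⟩ ?_)
      rw [sandwichedRenyi, if_neg, EReal.top_sub_coe, EReal.coe_mul_top_of_pos (by norm_num)]
      rintro (h | h)
      · norm_num at h
      · exact h.2.2 hperp
    rw [htop]
    refine tendsto_const_nhds.congr' ?_
    filter_upwards [Filter.eventually_gt_atTop 0] with n hn
    have hn' : (0 : ℝ) < n := by exact_mod_cast hn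
    rw [elog2, if_pos (smoothingQuantity_tensorPower_of_disjoint U hp1 hq hdisj _ hn),
      EReal.coe_mul_bot_of_neg (div_neg_of_neg_of_pos (by norm_num) hn')]
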